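/- A Diophantine $n$-gon (convex or concave) has as vertices $n$ distinct points of the Euclidean plane, not all on one line, such that the distance between any two of them, i.e. the length of every side and every diagonal, is a natural number. Suppose that some side or diagonal $AB$ of a Diophantine $n$-gon has length $3$, and that no other vertex lies on the line $AB$, so that $A$, $B$ and any third vertex form a nondegenerate triangle (this holds in particular whenever no three of the vertices are collinear). Then $3 \le n \le 7$. -/

import Mathlib

/-- `P 0, …, P (n - 1)` are the vertices of a Diophantine (integral) `n`-gon in the Euclidean plane,
convex or concave: distinct points, not all on one line, such that the distance between any two of
them (that is, the length of every side and of every diagonal) is a natural number. -/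
structure IsDiophantineNGon (n : ℕ) (P : Fin n → EuclideanSpace ℝ (Fin 2)) : Prop where
  injective : Function.Injective P
  not_collinear : ¬ Collinear ℝ (Set.range P)
  dist_natural : ∀ i j : Fin n, ∃ m : ℕ, dist (P i) (P j) = (m : ℝ)

/-- The side or diagonal joining the vertices `P i` and `P j` forms a genuine (nondegenerate)
triangle with every other vertex: no third vertex lies on the line through `P i` and `P j`. -/
def SpansTriangles (n : ℕ) (P : Fin n → EuclideanSpace ℝ (Fin 2)) (i j : Fin n) : Prop :=
  ∀ k : Fin n, k ≠ i → k ≠ j → ¬ Collinear ℝ {P i, P j, P k}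

/-! Put the foci `A`, `B` at distance 3. A further vertex at distances `a`, `b` has `d = a - b` in
{-2, ..., 2} by the strict triangle inequality, so it lies on one of five hyperbola branches (the
perpendicular bisector for `d = 0`). The branches `d = 0` and `d = ±2` carry at most one vertex each
(`same_branch_zero`, `same_branch_two`), the branches `d = ±1` at most two (`three_on_branch_one`).
If a branch `±1` carries two, their squared heights, scaled by 36, are `e z²` with `e ≡ 1 (mod 4)`,
while for even `d` they are `3 (mod 4)`; `no_mixed_heights` then excludes even `d`. So there are at
most max(5, 2 + 2) = 5 further vertices. -/

/-! ### Arithmetic of two points on one branch. -/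

/-- If `c² = t² + M σ` with `0 < σ ∣ t²`, then the squarefree part of `σ` divides `M`. -/
theorem exists_squarefree_param {c t M σ k : ℤ} (hσ : 0 < σ) (hk : σ * k = t ^ 2)
    (hc : c ^ 2 = t ^ 2 + M * σ) :
    ∃ g x y e : ℤ, 0 < g ∧ 0 < y ∧ Squarefree g ∧ g ∣ M ∧ σ = g * y ^ 2 ∧ t = g * x * y ∧
      k = g * x ^ 2 ∧ c = g * e * y ∧ g * e ^ 2 = g * x ^ 2 + M := by
  obtain ⟨a, b, hab, hsq⟩ := Nat.sq_mul_squarefree σ.toNat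
  have hσ' : (b : ℤ) ^ 2 * a = σ := by
    have : ((b ^ 2 * a : ℕ) : ℤ) = (σ.toNat : ℤ) := by rw [hab]
    rw [Int.toNat_of_nonneg hσ.le] at this
    exact_mod_cast this
  have hg : Squarefree (a : ℤ) := Int.squarefree_natCast.2 hsq
  generalize (a : ℤ) = g at *
  have hb0 : (0 : ℤ) ≤ b := Int.natCast_nonneg b
  generalize (b : ℤ) = y at *
  have hy0 : y ≠ 0 := by rintro rfl; simp at hσ'; omega
  have hy : 0 < y := lt_of_le_of_ne hb0 (Ne.symm hy0)
  have hgpos : 0 < g := by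
    by_contra h
    nlinarith [mul_nonneg (sq_nonneg y) (neg_nonneg.2 (not_lt.1 h))]
  -- Both `t²` and `c²` are multiples of `σ = g y²`, so `t` and `c` are multiples of `g y`: `y`
  -- divides by comparing squares, `g` because it is squarefree.
  have hyt : y ∣ t := (Int.pow_dvd_pow_iff two_ne_zero).1 ⟨g * k, by rw [← hk, ← hσ']; ring⟩
  obtain ⟨t', rfl⟩ := hyt
  have hy2 : y ^ 2 ≠ 0 := pow_ne_zero 2 hy0
  have hgk : g * k = t' ^ 2 := mul_left_cancel₀ hy2 (by rw [← hσ'] at hk; linear_combination hk)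
  obtain ⟨x, rfl⟩ : g ∣ t' := (hg.dvd_pow_iff_dvd two_ne_zero).1 ⟨k, hgk.symm⟩
  have hyc : y ∣ c := (Int.pow_dvd_pow_iff two_ne_zero).1
    ⟨g * (g * x ^ 2 + M), by rw [hc, ← hσ']; ring⟩
  obtain ⟨c', rfl⟩ := hyc
  have hc' : c' ^ 2 = g * (g * x ^ 2 + M) :=
    mul_left_cancel₀ hy2 (by rw [← hσ'] at hc; linear_combination hc)
  obtain ⟨e, rfl⟩ : g ∣ c' := (hg.dvd_pow_iff_dvd two_ne_zero).1 ⟨_, hc'⟩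
  have he : g * e ^ 2 = g * x ^ 2 + M :=
    mul_left_cancel₀ hgpos.ne' (by linear_combination hc')
  refine ⟨g, x, y, e, hgpos, hy, hg, ⟨e ^ 2 - x ^ 2, by linear_combination -he⟩, ?_, ?_, ?_, ?_, he⟩
  · linear_combination -hσ'
  · ring
  · exact mul_left_cancel₀ hgpos.ne' (by linear_combination hgk)
  · ring

/-- The Cayley-Menger relation for two points lying on the same branch of a hyperbola whose foci
are at distance `3`. -/
theorem cayleyMenger_same_branch {d s₁ s₂ t c : ℤ} {Y₁ Y₂ : ℝ}
    (h₁ : Y₁ ^ 2 = ((9 - d ^ 2) * (s₁ ^ 2 - 9) : ℤ))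
    (h₂ : Y₂ ^ 2 = ((9 - d ^ 2) * (s₂ ^ 2 - 9) : ℤ))
    (hc : 36 * (c : ℝ) ^ 2 = ((d * s₁ - d * s₂ : ℤ) : ℝ) ^ 2 + (Y₁ - Y₂) ^ 2)
    (ht : s₁ = s₂ + 2 * t) :
    9 * (c ^ 2 - t ^ 2) ^ 2 + (9 - d ^ 2) ^ 2 * t ^ 2 =
      (9 - d ^ 2) * (c ^ 2 - t ^ 2) * (s₁ * s₂ - 9) := by
  subst ht
  -- Expanding `(Y₁ - Y₂)²` makes `2 Y₁ Y₂` an integer; squaring it eliminates the heights and gives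
  -- 144 times the claim.
  have hw : 2 * (Y₁ * Y₂) = (((9 - d ^ 2) * ((s₂ + 2 * t) ^ 2 - 9) + (9 - d ^ 2) * (s₂ ^ 2 - 9)
      + (d * (2 * t)) ^ 2 - 36 * c ^ 2 : ℤ) : ℝ) := by
    push_cast at *
    linear_combination h₁ + h₂ + hc
  have hw2 : (2 * (Y₁ * Y₂)) ^ 2 = ((4 * ((9 - d ^ 2) * ((s₂ + 2 * t) ^ 2 - 9)) *
      ((9 - d ^ 2) * (s₂ ^ 2 - 9)) : ℤ) : ℝ) := by
    push_cast at *
    linear_combination 4 * Y₂ ^ 2 * h₁ + 4 * (9 - (d : ℝ) ^ 2) * (((s₂ : ℝ) + 2 * t) ^ 2 - 9) * h₂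
  rw [hw] at hw2
  have := Int.cast_injective (α := ℝ) (by exact_mod_cast hw2 :
    ((((9 - d ^ 2) * ((s₂ + 2 * t) ^ 2 - 9) + (9 - d ^ 2) * (s₂ ^ 2 - 9)
      + (d * (2 * t)) ^ 2 - 36 * c ^ 2) ^ 2 : ℤ) : ℝ) = _)
  have h144 : (144 : ℤ) ≠ 0 := by norm_num
  apply mul_left_cancel₀ h144
  linear_combination this

theorem not_sq_three_mod_four {f z : ℤ} (hf : f % 4 = 3) : z ^ 2 ≠ f := by
  rintro rfl
  rcases Int.even_or_odd' z with ⟨k, rfl | rfl⟩ <;> ring_nf at hf <;> omega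

/-! ### Branches with even difference. -/

/-- Two points with difference of focal distances `0` do not have integral distance. -/
theorem same_branch_zero {s₁ s₂ c : ℤ} {Y₁ Y₂ : ℝ} (hs₁ : s₁ % 2 = 0)
    (h₁ : Y₁ ^ 2 = (9 * (s₁ ^ 2 - 9) : ℤ))
    (h₂ : Y₂ ^ 2 = (9 * (s₂ ^ 2 - 9) : ℤ))
    (hc : 36 * (c : ℝ) ^ 2 = (Y₁ - Y₂) ^ 2) (hc0 : c ≠ 0) : False := by
  have h : ∃ u : ℤ, Y₁ - Y₂ = u := by
    rcases sq_eq_sq_iff_eq_or_eq_neg.1 (by linear_combination -hc : (Y₁ - Y₂) ^ 2 = (6 * (c : ℝ)) ^ 2)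
      with h | h
    · exact ⟨6 * c, by rw [h]; push_cast; ring⟩
    · exact ⟨-(6 * c), by rw [h]; push_cast; ring⟩
  obtain ⟨u, hu⟩ := h
  have hu2 : u ^ 2 = 36 * c ^ 2 := by
    rw [hu] at hc; exact_mod_cast hc.symm
  have hu0 : u ≠ 0 := by
    rintro rfl
    apply hc0
    have : c ^ 2 = 0 := by linarith
    exact pow_eq_zero_iff two_ne_zero |>.1 this
  set f₁ : ℤ := 9 * (s₁ ^ 2 - 9) with hf₁
  -- `Y₁ - Y₂` and `Y₁² - Y₂²` are integers, so `Y₁` is rational and `f₁` a perfect square; but `f₁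
  -- ≡ 3 (mod 4)`.
  have hlin : 2 * u * Y₁ = ((f₁ - 9 * (s₂ ^ 2 - 9) + u ^ 2 : ℤ) : ℝ) := by
    have : Y₂ = Y₁ - u := by linarith
    subst this
    push_cast at *
    linear_combination h₁ - h₂
  have hsq : (2 * u) ^ 2 * f₁ = (f₁ - 9 * (s₂ ^ 2 - 9) + u ^ 2) ^ 2 := by
    have : (((2 * u) ^ 2 * f₁ : ℤ) : ℝ) = (((f₁ - 9 * (s₂ ^ 2 - 9) + u ^ 2) ^ 2 : ℤ) : ℝ) := by
      rw [Int.cast_pow, ← hlin, Int.cast_mul, ← h₁]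
      push_cast; ring
    exact_mod_cast this
  obtain ⟨z, hz⟩ : 2 * u ∣ f₁ - 9 * (s₂ ^ 2 - 9) + u ^ 2 :=
    (Int.pow_dvd_pow_iff two_ne_zero).1 ⟨f₁, hsq.symm⟩
  have h2u : (2 * u) ^ 2 ≠ 0 := pow_ne_zero 2 (mul_ne_zero two_ne_zero hu0)
  have : z ^ 2 = f₁ := mul_left_cancel₀ h2u (by rw [hsq, hz]; ring)
  refine not_sq_three_mod_four ?_ this
  obtain ⟨m, rfl⟩ : ∃ m, s₁ = 2 * m := ⟨s₁ / 2, by omega⟩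
  rw [hf₁]; ring_nf; omega

/-- In the reduced Cayley-Menger relation `σ` is positive unless the points coincide. -/
theorem pos_of_relation {σ t c P M : ℤ} (hP : 0 < P) (h : 9 * σ ^ 2 + t ^ 2 = σ * P)
    (hc : c ^ 2 = t ^ 2 + M * σ) (hc0 : c ≠ 0) : 0 < σ := by
  have h0 : 0 ≤ σ := by
    by_contra hneg
    push Not at hneg
    nlinarith [mul_pos (neg_pos.2 hneg) hP, sq_nonneg σ, sq_nonneg t]
  rcases h0.lt_or_eq with h1 | rfl
  · exact h1
  · exfalso
    have ht : t ^ 2 = 0 := by linarith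
    rw [ht] at hc
    exact hc0 (pow_eq_zero_iff two_ne_zero |>.1 (by linarith))

/-- Two points on the branch with difference of focal distances `±2` do not have integral
distance. -/
theorem same_branch_two {d s₁ s₂ c : ℤ} {Y₁ Y₂ : ℝ} (hd : d ^ 2 = 4) (hs₁ : s₁ % 2 = 0)
    (hs₂ : s₂ % 2 = 0) (hp₁ : 3 < s₁) (hp₂ : 3 < s₂)
    (h₁ : Y₁ ^ 2 = ((9 - d ^ 2) * (s₁ ^ 2 - 9) : ℤ))
    (h₂ : Y₂ ^ 2 = ((9 - d ^ 2) * (s₂ ^ 2 - 9) : ℤ))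
    (hc : 36 * (c : ℝ) ^ 2 = ((d * s₁ - d * s₂ : ℤ) : ℝ) ^ 2 + (Y₁ - Y₂) ^ 2)
    (hc0 : c ≠ 0) : False := by
  obtain ⟨t, ht⟩ : ∃ t, s₁ = s₂ + 2 * t := ⟨(s₁ - s₂) / 2, by omega⟩
  have hcm := cayleyMenger_same_branch h₁ h₂ hc ht
  rw [hd] at hcm
  have h5 : (5 : ℤ) ∣ c ^ 2 - t ^ 2 := by
    have : (5 : ℤ) ∣ 9 * (c ^ 2 - t ^ 2) ^ 2 :=
      ⟨(c ^ 2 - t ^ 2) * (s₁ * s₂ - 9) - 5 * t ^ 2, by linear_combination hcm⟩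
    have hp : Prime (5 : ℤ) := by norm_num
    exact hp.dvd_of_dvd_pow ((hp.dvd_or_dvd this).resolve_left (by norm_num))
  obtain ⟨σ, hσ⟩ := h5
  have hc' : c ^ 2 = t ^ 2 + 5 * σ := by linarith
  rw [hσ] at hcm
  have hrel : 9 * σ ^ 2 + t ^ 2 = σ * (s₁ * s₂ - 9) := by linarith
  have hpos := pos_of_relation (by nlinarith) hrel hc' hc0
  obtain ⟨g, x, y, e, hg0, -, -, hg5, rfl, -, hk, -, -⟩ :=
    exists_squarefree_param hpos (k := s₁ * s₂ - 9 - 9 * σ) (by linear_combination -hrel) hc'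
  obtain ⟨m₁, rfl⟩ : ∃ m, s₁ = 2 * m := ⟨s₁ / 2, by omega⟩
  obtain ⟨m₂, rfl⟩ : ∃ m, s₂ = 2 * m := ⟨s₂ / 2, by omega⟩
  have hg1 : g % 4 = 1 := by
    have h1 : g ≤ 5 := Int.le_of_dvd (by norm_num) hg5
    interval_cases g <;> omega
  obtain ⟨q, rfl⟩ : ∃ q, g = 4 * q + 1 := ⟨g / 4, by omega⟩
  -- From `g (x² + 9 y²) = s₁ s₂ - 9` with `s₁`, `s₂` even and `g ≡ 1 (mod 4)`.
  have hmod : (x ^ 2 + y ^ 2) % 4 = 3 := by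
    have : x ^ 2 + y ^ 2 = 4 * (m₁ * m₂ - 9 * q * y ^ 2 - q * x ^ 2 - 2 * y ^ 2 - 3) + 3 := by
      linear_combination -hk
    omega
  have hx : x ^ 2 % 4 = 0 ∨ x ^ 2 % 4 = 1 := by
    rcases Int.even_or_odd' x with ⟨k, rfl | rfl⟩ <;> ring_nf <;> omega
  have hy : y ^ 2 % 4 = 0 ∨ y ^ 2 % 4 = 1 := by
    rcases Int.even_or_odd' y with ⟨k, rfl | rfl⟩ <;> ring_nf <;> omega
  omega

/-! ### Branches with difference `±1`. -/

theorem sq_eq_one_of_sq_eq_sq_add_eight {e x : ℤ} (h : e ^ 2 = x ^ 2 + 8) : x ^ 2 = 1 := by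
  rw [← sq_abs e, ← sq_abs x] at h
  rw [← sq_abs x]
  have hx := abs_nonneg x
  have he := abs_nonneg e
  generalize |x| = x at *
  generalize |e| = e at *
  have h1 : x < e := by nlinarith
  have h3 : x ≤ 4 := by nlinarith
  have h4 : e ≤ 5 := by nlinarith
  interval_cases x <;> interval_cases e <;> omega

theorem eq_zero_of_sq_eq_sq_add_four {e x : ℤ} (h : e ^ 2 = x ^ 2 + 4) : x = 0 := by
  rw [← sq_abs e, ← sq_abs x] at h
  rw [← abs_eq_zero]
  have hx := abs_nonneg x
  have he := abs_nonneg e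
  generalize |x| = x at *
  generalize |e| = e at *
  have h1 : x < e := by nlinarith
  have h3 : x ≤ 2 := by nlinarith
  have h4 : e ≤ 3 := by nlinarith
  interval_cases x <;> interval_cases e <;> omega

/-- Two points at integral distance on the branch with difference of focal distances `±1` are
either mirror images, or satisfy a quadratic relation. -/
theorem same_branch_one {d s₁ s₂ c : ℤ} {Y₁ Y₂ : ℝ} (hd : d ^ 2 = 1) (hs₁ : s₁ % 2 = 1)
    (hs₂ : s₂ % 2 = 1) (hp₁ : 3 < s₁) (hp₂ : 3 < s₂)
    (h₁ : Y₁ ^ 2 = ((9 - d ^ 2) * (s₁ ^ 2 - 9) : ℤ))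
    (h₂ : Y₂ ^ 2 = ((9 - d ^ 2) * (s₂ ^ 2 - 9) : ℤ))
    (hc : 36 * (c : ℝ) ^ 2 = ((d * s₁ - d * s₂ : ℤ) : ℝ) ^ 2 + (Y₁ - Y₂) ^ 2)
    (hc0 : c ≠ 0) :
    (s₁ = s₂ ∧ ∃ y, 18 * y ^ 2 = s₁ ^ 2 - 9) ∨
      (s₁ ≠ s₂ ∧ 4 * c ^ 2 = 9 * (s₁ - s₂) ^ 2 ∧ 9 * (s₁ - s₂) ^ 2 + 40 = 4 * s₁ * s₂) := by
  obtain ⟨t, ht⟩ : ∃ t, s₁ = s₂ + 2 * t := ⟨(s₁ - s₂) / 2, by omega⟩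
  have hcm := cayleyMenger_same_branch h₁ h₂ hc ht
  rw [hd] at hcm
  have h8 : (8 : ℤ) ∣ c ^ 2 - t ^ 2 := by
    have h4 : (4 : ℤ) ∣ c ^ 2 - t ^ 2 := by
      have h : (4 : ℤ) ^ 2 ∣ (3 * (c ^ 2 - t ^ 2)) ^ 2 := by
        obtain ⟨m₁, rfl⟩ : ∃ m, s₁ = 2 * m + 1 := ⟨s₁ / 2, by omega⟩
        obtain ⟨m₂, rfl⟩ : ∃ m, s₂ = 2 * m + 1 := ⟨s₂ / 2, by omega⟩
        exact ⟨(c ^ 2 - t ^ 2) * (2 * m₁ * m₂ + m₁ + m₂ - 4) - 4 * t ^ 2, by linear_combination hcm⟩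
      have := (Int.pow_dvd_pow_iff two_ne_zero).1 h
      omega
    obtain ⟨κ, hκ⟩ := h4
    rw [hκ] at hcm ⊢
    have h2 : Even (9 * κ ^ 2) := ⟨κ * (s₁ * s₂ - 9) - 2 * t ^ 2, by linarith⟩
    have : Even κ := by
      rcases Int.even_mul.1 h2 with h | h
      · exact absurd h (by decide)
      · exact (Int.even_pow.1 h).1
    obtain ⟨l, rfl⟩ := this
    exact ⟨l, by ring⟩
  obtain ⟨σ, hσ⟩ := h8
  have hc' : c ^ 2 = t ^ 2 + 8 * σ := by linarith
  rw [hσ] at hcm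
  have hrel : 9 * σ ^ 2 + t ^ 2 = σ * (s₁ * s₂ - 9) := by linarith
  have hpos := pos_of_relation (by nlinarith) hrel hc' hc0
  obtain ⟨g, x, y, e, hg0, hy0, hsq, hg8, rfl, rfl, hk, rfl, he⟩ :=
    exists_squarefree_param hpos (k := s₁ * s₂ - 9 - 9 * σ) (by linear_combination -hrel) hc'
  -- `g` is a squarefree divisor of 8. For `g = 1`, `e² = x² + 8` leaves only `x = ±1`, `e = ±3`;
  -- for `g = 2`, `e² = x² + 4` forces `t = 0`.
  have hg : g = 1 ∨ g = 2 := by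
    have h1 : g ≤ 8 := Int.le_of_dvd (by norm_num) hg8
    have h4 : ¬ (2 * 2 ∣ g) := fun h => by
      have := Int.isUnit_iff.1 (hsq 2 h)
      omega
    interval_cases g <;> omega
  rcases hg with rfl | rfl
  · right
    have hx : x ^ 2 = 1 := sq_eq_one_of_sq_eq_sq_add_eight (by linarith : e ^ 2 = x ^ 2 + 8)
    have he9 : e ^ 2 = 9 := by linarith
    have hdiff : (s₁ - s₂) ^ 2 = 4 * y ^ 2 := by
      rw [ht]; linear_combination 4 * y ^ 2 * hx
    refine ⟨?_, ?_, ?_⟩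
    · rintro rfl
      simp at hdiff
      omega
    · rw [hdiff]; linear_combination 4 * y ^ 2 * he9
    · rw [hdiff]; linear_combination -4 * hk - 4 * hx
  · left
    have hx : x = 0 := eq_zero_of_sq_eq_sq_add_four (by linarith : e ^ 2 = x ^ 2 + 4)
    subst hx
    obtain rfl : s₁ = s₂ := by simpa using ht
    exact ⟨rfl, y, by linear_combination -hk⟩

/-- The squared height over the foci of a point that shares its branch `±1` with another one is a
square or five times a square. -/
theorem height_of_same_branch_one {s₁ s₂ c : ℤ}
    (h : (s₁ = s₂ ∧ ∃ y, 18 * y ^ 2 = s₁ ^ 2 - 9) ∨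
      (s₁ ≠ s₂ ∧ 4 * c ^ 2 = 9 * (s₁ - s₂) ^ 2 ∧ 9 * (s₁ - s₂) ^ 2 + 40 = 4 * s₁ * s₂)) :
    ∃ e z : ℤ, e % 4 = 1 ∧ 8 * (s₁ ^ 2 - 9) = e * z ^ 2 := by
  rcases h with ⟨-, y, hy⟩ | ⟨-, -, h⟩
  · exact ⟨1, 12 * y, by norm_num, by linear_combination -8 * hy⟩
  · have h10 : 10 * (s₁ - s₂) ^ 2 + 40 = (s₁ + s₂) ^ 2 := by linear_combination h
    have hd : (10 : ℤ) ∣ s₁ + s₂ := by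
      have h2 : (2 : ℤ) ∣ s₁ + s₂ :=
        Int.prime_two.dvd_of_dvd_pow (n := 2) ⟨5 * (s₁ - s₂) ^ 2 + 20, by linear_combination -h10⟩
      have h5 : (5 : ℤ) ∣ s₁ + s₂ :=
        (by norm_num : Prime (5 : ℤ)).dvd_of_dvd_pow (n := 2)
          ⟨2 * (s₁ - s₂) ^ 2 + 8, by linear_combination -h10⟩
      omega
    obtain ⟨w, hw⟩ := hd
    obtain rfl : s₂ = 10 * w - s₁ := by linarith
    -- With `s₁ + s₂ = 10 w` the relation becomes `2 s₁² - 20 s₁ w + 45 w² + 2 = 0`, on which `8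
    -- (s₁² - 9) = 5 (4 s₁ - 18 w)²`.
    refine ⟨5, 4 * s₁ - 18 * w, by norm_num, ?_⟩
    linarith

/-- A point whose squared height is `e z²`, `e ≡ 1 (mod 4)`, does not have integral distance from
a point whose squared height is `3 (mod 4)`. -/
theorem no_mixed_heights {X₁ X₂ e z f c : ℤ} {Y₁ Y₂ : ℝ} (he : e % 4 = 1) (hf : f % 4 = 3)
    (h₁ : Y₁ ^ 2 = (e * z ^ 2 : ℤ)) (hY₁ : Y₁ ≠ 0) (h₂ : Y₂ ^ 2 = (f : ℤ))
    (hc : 36 * (c : ℝ) ^ 2 = ((X₁ - X₂ : ℤ) : ℝ) ^ 2 + (Y₁ - Y₂) ^ 2) : False := by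
  have hw : 2 * (Y₁ * Y₂) = ((e * z ^ 2 + f + (X₁ - X₂) ^ 2 - 36 * c ^ 2 : ℤ) : ℝ) := by
    push_cast at *
    linear_combination h₁ + h₂ + hc
  generalize e * z ^ 2 + f + (X₁ - X₂) ^ 2 - 36 * c ^ 2 = w at hw
  -- Hence `e f` is a perfect square, although it is `3 (mod 4)`.
  have hw2 : w ^ 2 = (2 * z) ^ 2 * (e * f) := by
    have : ((w ^ 2 : ℤ) : ℝ) = (((2 * z) ^ 2 * (e * f) : ℤ) : ℝ) := by
      push_cast at *
      rw [← hw]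
      linear_combination 4 * Y₂ ^ 2 * h₁ + 4 * (e : ℝ) * z ^ 2 * h₂
    exact_mod_cast this
  have hz : (2 * z) ^ 2 ≠ 0 := by
    intro h
    have hz0 : z = 0 := by
      have := pow_eq_zero_iff two_ne_zero |>.1 h
      omega
    subst hz0
    simp at h₁
    exact hY₁ h₁
  obtain ⟨v, rfl⟩ : 2 * z ∣ w := by
    have := (Int.pow_dvd_pow_iff two_ne_zero).1 (⟨e * f, hw2⟩ : (2 * z) ^ 2 ∣ w ^ 2)
    exact this
  have : v ^ 2 = e * f := mul_left_cancel₀ hz (by linear_combination hw2)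
  refine not_sq_three_mod_four ?_ this
  rw [Int.mul_emod, he, hf]; norm_num

/-- Three points of a branch `±1` do not have pairwise integral distances. -/
theorem three_on_branch_one {d s₁ s₂ s₃ c₁₂ c₁₃ c₂₃ : ℤ} {Y₁ Y₂ Y₃ : ℝ} (hd : d ^ 2 = 1)
    (hs₁ : s₁ % 2 = 1) (hs₂ : s₂ % 2 = 1) (hs₃ : s₃ % 2 = 1)
    (hp₁ : 3 < s₁) (hp₂ : 3 < s₂) (hp₃ : 3 < s₃)
    (h₁ : Y₁ ^ 2 = ((9 - d ^ 2) * (s₁ ^ 2 - 9) : ℤ))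
    (h₂ : Y₂ ^ 2 = ((9 - d ^ 2) * (s₂ ^ 2 - 9) : ℤ))
    (h₃ : Y₃ ^ 2 = ((9 - d ^ 2) * (s₃ ^ 2 - 9) : ℤ))
    (hY₁ : Y₁ ≠ 0) (hY₂ : Y₂ ≠ 0) (hY₃ : Y₃ ≠ 0)
    (k₁₂ : 36 * (c₁₂ : ℝ) ^ 2 = ((d * s₁ - d * s₂ : ℤ) : ℝ) ^ 2 + (Y₁ - Y₂) ^ 2)
    (k₁₃ : 36 * (c₁₃ : ℝ) ^ 2 = ((d * s₁ - d * s₃ : ℤ) : ℝ) ^ 2 + (Y₁ - Y₃) ^ 2)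
    (k₂₃ : 36 * (c₂₃ : ℝ) ^ 2 = ((d * s₂ - d * s₃ : ℤ) : ℝ) ^ 2 + (Y₂ - Y₃) ^ 2)
    (n₁₂ : c₁₂ ≠ 0) (n₁₃ : c₁₃ ≠ 0) (n₂₃ : c₂₃ ≠ 0) : False := by
  have mirror : ∀ {s s' c : ℤ} {Y Y' : ℝ}, s = s' → Y ^ 2 = ((9 - d ^ 2) * (s ^ 2 - 9) : ℤ) →
      Y' ^ 2 = ((9 - d ^ 2) * (s' ^ 2 - 9) : ℤ) →
      36 * (c : ℝ) ^ 2 = ((d * s - d * s' : ℤ) : ℝ) ^ 2 + (Y - Y') ^ 2 → c ≠ 0 → Y = -Y' := by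
    rintro s _ c Y Y' rfl h h' hc hc0
    rcases sq_eq_sq_iff_eq_or_eq_neg.1 (h.trans h'.symm) with e | e
    · exfalso
      rw [e] at hc
      simp at hc
      exact hc0 hc
    · exact e
  -- A third point equidistant from two mirror images would lie on the axis `AB`.
  have mixed : ∀ {s s' c c' : ℤ} {Y Y' Y'' : ℝ}, Y = -Y' → Y' ≠ 0 → Y'' ≠ 0 →
      4 * c ^ 2 = 9 * (s - s') ^ 2 → 4 * c' ^ 2 = 9 * (s - s') ^ 2 →
      36 * (c : ℝ) ^ 2 = ((d * s - d * s' : ℤ) : ℝ) ^ 2 + (Y - Y'') ^ 2 →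
      36 * (c' : ℝ) ^ 2 = ((d * s - d * s' : ℤ) : ℝ) ^ 2 + (Y' - Y'') ^ 2 → False := by
    rintro s s' c c' Y Y' Y'' rfl hY' hY'' hc hc' h h'
    have hcc : ((c ^ 2 : ℤ) : ℝ) = ((c' ^ 2 : ℤ) : ℝ) := by
      rw [show c ^ 2 = c' ^ 2 by linarith]
    push_cast at hcc
    have : Y' * Y'' = 0 := by linarith
    exact (mul_ne_zero hY' hY'') this
  have flip : ∀ {s s' c : ℤ} {Y Y' : ℝ},
      36 * (c : ℝ) ^ 2 = ((d * s - d * s' : ℤ) : ℝ) ^ 2 + (Y - Y') ^ 2 →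
      36 * (c : ℝ) ^ 2 = ((d * s' - d * s : ℤ) : ℝ) ^ 2 + (Y' - Y) ^ 2 := by
    intro s s' c Y Y' h
    rw [h]; push_cast; ring
  have r₁₂ := same_branch_one hd hs₁ hs₂ hp₁ hp₂ h₁ h₂ k₁₂ n₁₂
  have r₁₃ := same_branch_one hd hs₁ hs₃ hp₁ hp₃ h₁ h₃ k₁₃ n₁₃
  have r₂₃ := same_branch_one hd hs₂ hs₃ hp₂ hp₃ h₂ h₃ k₂₃ n₂₃
  rcases r₁₂ with ⟨e₁₂, -⟩ | ⟨e₁₂, f₁₂, g₁₂⟩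
  · have m₁₂ := mirror e₁₂ h₁ h₂ k₁₂ n₁₂
    rcases r₁₃ with ⟨e₁₃, -⟩ | ⟨e₁₃, f₁₃, -⟩
    · have m₁₃ := mirror e₁₃ h₁ h₃ k₁₃ n₁₃
      have m₂₃ := mirror (e₁₂.symm.trans e₁₃) h₂ h₃ k₂₃ n₂₃
      exact hY₁ (by linarith)
    · rcases r₂₃ with ⟨e₂₃, -⟩ | ⟨-, f₂₃, -⟩
      · exact e₁₃ (e₁₂.trans e₂₃)
      · subst e₁₂
        exact mixed m₁₂ hY₂ hY₃ f₁₃ f₂₃ k₁₃ k₂₃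
  · rcases r₁₃ with ⟨e₁₃, -⟩ | ⟨e₁₃, f₁₃, g₁₃⟩
    · have m₁₃ := mirror e₁₃ h₁ h₃ k₁₃ n₁₃
      rcases r₂₃ with ⟨e₂₃, -⟩ | ⟨-, f₂₃, -⟩
      · exact e₁₂ (e₁₃.trans e₂₃.symm)
      · subst e₁₃
        exact mixed m₁₃ hY₃ hY₂ f₁₂ (by linear_combination f₂₃) k₁₂ (flip k₂₃)
    · rcases r₂₃ with ⟨e₂₃, -⟩ | ⟨e₂₃, -, g₂₃⟩
      · have m₂₃ := mirror e₂₃ h₂ h₃ k₂₃ n₂₃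
        subst e₂₃
        exact mixed m₂₃ hY₃ hY₁ (by linear_combination f₁₂) (by linear_combination f₁₃)
          (flip k₁₂) (flip k₁₃)
      -- With no mirror pair, subtracting the symmetric quadratic relations leaves linear equations
      -- that force `s₁ = s₂`.
      · have a : (s₂ - s₃) * (9 * (s₂ + s₃) - 22 * s₁) = 0 := by linear_combination g₁₂ - g₁₃
        have b : (s₁ - s₃) * (9 * (s₁ + s₃) - 22 * s₂) = 0 := by linear_combination g₁₂ - g₂₃
        have a' := (mul_eq_zero.1 a).resolve_left (sub_ne_zero.2 e₂₃)
        have b' := (mul_eq_zero.1 b).resolve_left (sub_ne_zero.2 e₁₃)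
        exact e₁₂ (by linarith)

/-! ### Counting points over all branches. -/

/-- Scaled coordinates of an integral point over a segment of length `3`: `d` and `s` are the
difference and the sum of the distances to the end points, `Y` is six times the signed height. -/
structure IsFocalPoint (d s : ℤ) (Y : ℝ) : Prop where
  three_lt : 3 < s
  parity : s % 2 = d % 2
  ne_zero : Y ≠ 0
  sq_eq : Y ^ 2 = ((9 - d ^ 2) * (s ^ 2 - 9) : ℤ)

theorem IsFocalPoint.sq_lt {d s : ℤ} {Y : ℝ} (h : IsFocalPoint d s Y) : d ^ 2 < 9 := by
  have h1 : (0 : ℝ) < ((9 - d ^ 2) * (s ^ 2 - 9) : ℤ) := h.sq_eq ▸ sq_pos_of_ne_zero h.ne_zero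
  have h2 : 0 < (9 - d ^ 2) * (s ^ 2 - 9) := by exact_mod_cast h1
  have h3 : 0 < s ^ 2 - 9 := by nlinarith [h.three_lt]
  linarith [pos_of_mul_pos_left h2 h3.le]

/-- Families of focal points with pairwise integral distances have at most five members. -/
theorem card_le_five {ι : Type*} [DecidableEq ι] (S : Finset ι) (d s : ι → ℤ) (Y : ι → ℝ)
    (hF : ∀ k ∈ S, IsFocalPoint (d k) (s k) (Y k))
    (hc : ∀ k ∈ S, ∀ l ∈ S, k ≠ l → ∃ c : ℤ, c ≠ 0 ∧
      36 * (c : ℝ) ^ 2 = ((d k * s k - d l * s l : ℤ) : ℝ) ^ 2 + (Y k - Y l) ^ 2) :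
    S.card ≤ 5 := by
  have hd : ∀ k ∈ S, d k = -2 ∨ d k = -1 ∨ d k = 0 ∨ d k = 1 ∨ d k = 2 := by
    intro k hk
    have := (hF k hk).sq_lt
    have h1 : d k < 3 := by nlinarith
    have h2 : -3 < d k := by nlinarith
    omega
  by_cases hinj : Set.InjOn d S
  · have : (S.image d).card ≤ ({-2, -1, 0, 1, 2} : Finset ℤ).card := by
      apply Finset.card_le_card
      intro x hx
      obtain ⟨k, hk, rfl⟩ := Finset.mem_image.1 hx
      simpa using hd k hk
    rw [Finset.card_image_of_injOn hinj] at this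
    exact this
  · simp only [Set.InjOn, not_forall] at hinj
    obtain ⟨k, hk, l, hl, hdkl, hkl⟩ := hinj
    have hk : k ∈ S := hk
    have hl : l ∈ S := hl
    obtain ⟨c, hc0, hckl⟩ := hc k hk l hl hkl
    have Fk := hF k hk
    have Fl := hF l hl
    have hkp := Fk.parity
    have hlp := Fl.parity
    have hks := Fk.sq_eq
    have hls := Fl.sq_eq
    rw [← hdkl] at hckl hlp hls
    have hone : d k ^ 2 = 1 := by
      rcases hd k hk with h | h | h | h | h
      · exact (same_branch_two (by rw [h]; norm_num) (by omega) (by omega) Fk.three_lt Fl.three_lt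
          hks hls hckl hc0).elim
      · rw [h]; norm_num
      · rw [h] at hks hls hckl
        exact (same_branch_zero (s₁ := s k) (by omega) (by simpa using hks) (by simpa using hls)
          (by simpa using hckl) hc0).elim
      · rw [h]; norm_num
      · exact (same_branch_two (by rw [h]; norm_num) (by omega) (by omega) Fk.three_lt Fl.three_lt
          hks hls hckl hc0).elim
    have hk1 : d k % 2 = 1 := by rcases sq_eq_one_iff.1 hone with h | h <;> rw [h] <;> rfl
    obtain ⟨e, z, he, hez⟩ := height_of_same_branch_one
      (same_branch_one hone (by omega) (by omega) Fk.three_lt Fl.three_lt hks hls hckl hc0)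
    have hkY : Y k ^ 2 = (e * z ^ 2 : ℤ) := by rw [hks, ← hez, hone]; norm_num
    have hpm : ∀ m ∈ S, d m = -1 ∨ d m = 1 := by
      intro m hm
      by_contra hcon
      have hkm : k ≠ m := by
        rintro rfl
        exact hcon ((sq_eq_one_iff.1 hone).symm)
      obtain ⟨c', -, hc'⟩ := hc k hk m hm hkm
      have Fm := hF m hm
      have hmp := Fm.parity
      refine no_mixed_heights he ?_ hkY Fk.ne_zero Fm.sq_eq hc'
      obtain ⟨r, hr⟩ : ∃ r, s m = 2 * r := ⟨s m / 2, by have := hd m hm; omega⟩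
      rw [hr]
      rcases hd m hm with h | h | h | h | h
      · rw [h]; ring_nf; omega
      · omega
      · rw [h]; ring_nf; omega
      · omega
      · rw [h]; ring_nf; omega
    have htwo : ∀ δ : ℤ, δ ^ 2 = 1 → (S.filter fun m => d m = δ).card ≤ 2 := by
      intro δ hδ
      have hδ1 : δ % 2 = 1 := by rcases sq_eq_one_iff.1 hδ with h | h <;> rw [h] <;> rfl
      by_contra hcard
      push Not at hcard
      obtain ⟨x, y, w, hx, hy, hw, hxy, hxw, hyw⟩ := Finset.two_lt_card_iff.1 hcard
      rw [Finset.mem_filter] at hx hy hw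
      obtain ⟨c₁₂, n₁₂, k₁₂⟩ := hc x hx.1 y hy.1 hxy
      obtain ⟨c₁₃, n₁₃, k₁₃⟩ := hc x hx.1 w hw.1 hxw
      obtain ⟨c₂₃, n₂₃, k₂₃⟩ := hc y hy.1 w hw.1 hyw
      have F₁ := hF x hx.1
      have F₂ := hF y hy.1
      have F₃ := hF w hw.1
      rw [hx.2] at F₁ k₁₂ k₁₃
      rw [hy.2] at F₂ k₁₂ k₂₃
      rw [hw.2] at F₃ k₁₃ k₂₃
      exact three_on_branch_one hδ (F₁.parity.trans hδ1) (F₂.parity.trans hδ1)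
        (F₃.parity.trans hδ1) F₁.three_lt F₂.three_lt F₃.three_lt F₁.sq_eq F₂.sq_eq F₃.sq_eq
        F₁.ne_zero F₂.ne_zero F₃.ne_zero k₁₂ k₁₃ k₂₃ n₁₂ n₁₃ n₂₃
    have hsub : S ⊆ (S.filter fun m => d m = -1) ∪ (S.filter fun m => d m = 1) := by
      intro m hm
      simpa [hm] using hpm m hm
    have h1 := Finset.card_le_card hsub
    have h2 := Finset.card_union_le (S.filter fun m => d m = -1) (S.filter fun m => d m = 1)
    have h3 := htwo (-1) (by norm_num)
    have h4 := htwo 1 (by norm_num)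
    omega

/-! ### From the plane to focal coordinates. -/

/-- A point with vanishing cross product lies on the line through `A` and `B`. -/
theorem collinear_of_cross_eq_zero {A B C : EuclideanSpace ℝ (Fin 2)} (hAB : dist A B = 3)
    (h : (B 0 - A 0) * (C 1 - A 1) - (B 1 - A 1) * (C 0 - A 0) = 0) :
    Collinear ℝ {A, B, C} := by
  have h9 : (B 0 - A 0) ^ 2 + (B 1 - A 1) ^ 2 = 9 := by
    have := EuclideanSpace.dist_sq_eq A B
    rw [hAB, Fin.sum_univ_two, Real.dist_eq, Real.dist_eq, sq_abs, sq_abs] at this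
    linarith
  rw [collinear_iff_of_mem (p₀ := A) (by simp)]
  refine ⟨B - A, ?_⟩
  rintro p (rfl | rfl | rfl)
  · exact ⟨0, by simp⟩
  · exact ⟨1, by simp⟩
  -- The coefficient of the orthogonal projection onto `B - A`, with `9 = |AB|²`.
  · refine ⟨((B 0 - A 0) * (p 0 - A 0) + (B 1 - A 1) * (p 1 - A 1)) / 9, ?_⟩
    ext m
    fin_cases m
    · simp
      linear_combination (p 0 - A 0) / 9 * (-h9) - (B 1 - A 1) / 9 * h
    · simp
      linear_combination (p 1 - A 1) / 9 * (-h9) + (B 0 - A 0) / 9 * h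

theorem mainTheorem4 (n : ℕ) (P : Fin n → EuclideanSpace ℝ (Fin 2))
    (hP : IsDiophantineNGon n P) (i j : Fin n) (hij : dist (P i) (P j) = 3)
    (htri : SpansTriangles n P i j) :
    3 ≤ n ∧ n ≤ 7 := by
  have hne : i ≠ j := by rintro rfl; simp at hij
  have hdist : ∀ A B : EuclideanSpace ℝ (Fin 2),
      dist A B ^ 2 = (A 0 - B 0) ^ 2 + (A 1 - B 1) ^ 2 := by
    intro A B
    rw [EuclideanSpace.dist_sq_eq, Fin.sum_univ_two, Real.dist_eq, Real.dist_eq, sq_abs, sq_abs]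
  constructor
  · by_contra hn
    apply hP.not_collinear
    refine (collinear_pair ℝ (P i) (P j)).subset ?_
    rintro _ ⟨k, rfl⟩
    have : k = i ∨ k = j := by
      have h1 : i.1 ≠ j.1 := fun h => hne (Fin.ext h)
      rw [Fin.ext_iff, Fin.ext_iff]
      omega
    rcases this with rfl | rfl <;> simp
  choose D hD using hP.dist_natural
  have h9 : (P i 0 - P j 0) ^ 2 + (P i 1 - P j 1) ^ 2 = 9 := by
    rw [← hdist, hij]; norm_num
  have hDsq : ∀ k l, (D k l : ℝ) ^ 2 = (P k 0 - P l 0) ^ 2 + (P k 1 - P l 1) ^ 2 := by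
    intro k l
    rw [← hD, hdist]
  set Y : Fin n → ℝ := fun k =>
    2 * ((P j 0 - P i 0) * (P k 1 - P i 1) - (P j 1 - P i 1) * (P k 0 - P i 0)) with hY
  set d : Fin n → ℤ := fun k => (D i k : ℤ) - D j k with hd
  set s : Fin n → ℤ := fun k => (D i k : ℤ) + D j k with hs
  -- `d s = a² - b²` is six times the coordinate along `AB`, measured from the midpoint.
  have hX : ∀ k, ((d k * s k : ℤ) : ℝ) =
      2 * ((P j 0 - P i 0) * (P k 0 - P i 0) + (P j 1 - P i 1) * (P k 1 - P i 1)) - 9 := by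
    intro k
    have : ((d k * s k : ℤ) : ℝ) = (D i k : ℝ) ^ 2 - (D j k : ℝ) ^ 2 := by
      simp only [hd, hs]; push_cast; ring
    rw [this, hDsq, hDsq]
    linear_combination -h9
  have hYsq : ∀ k, Y k ^ 2 = ((9 - d k ^ 2) * (s k ^ 2 - 9) : ℤ) := by
    -- Pythagoras scaled by 36: measured from `P i`, that coordinate is `d s + 9`.
    intro k
    have h1 : (((9 - d k ^ 2) * (s k ^ 2 - 9) : ℤ) : ℝ) =
        36 * (D i k : ℝ) ^ 2 - (((d k * s k : ℤ) : ℝ) + 9) ^ 2 := by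
      simp only [hd, hs]; push_cast; ring
    rw [h1, hX, hDsq]
    simp only [hY]
    linear_combination -4 * ((P i 0 - P k 0) ^ 2 + (P i 1 - P k 1) ^ 2) * (-h9)
  have hcard := card_le_five ((Finset.univ.erase i).erase j) d s Y ?_ ?_
  · rw [Finset.card_erase_of_mem (by simp [hne.symm]), Finset.card_erase_of_mem (by simp),
      Finset.card_univ, Fintype.card_fin] at hcard
    omega
  · intro k hk
    have hki : k ≠ i := by simpa using (Finset.mem_erase.1 (Finset.mem_erase.1 hk).2).1
    have hkj : k ≠ j := (Finset.mem_erase.1 hk).1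
    have hY0 : Y k ≠ 0 := fun h =>
      htri k hki hkj (collinear_of_cross_eq_zero hij (by simpa [hY] using h))
    refine ⟨?_, ?_, hY0, hYsq k⟩
    · have h3 : (3 : ℤ) ≤ s k := by
        have := dist_triangle (P i) (P k) (P j)
        rw [hij, hD, dist_comm, hD] at this
        simp only [hs]
        exact_mod_cast this
      rcases h3.lt_or_eq with h | h
      · exact h
      · exfalso
        have := hYsq k
        rw [← h] at this
        simp at this
        exact hY0 this
    · simp only [hd, hs]; omega
  · intro k _ l _ hkl
    refine ⟨D k l, ?_, ?_⟩
    · intro h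
      have h0 : D k l = 0 := by exact_mod_cast h
      have := hD k l
      rw [h0, Nat.cast_zero, dist_eq_zero] at this
      exact hkl (hP.injective this)
    · have := hDsq k l
      rw [Int.cast_natCast, this, Int.cast_sub, hX, hX]
      simp only [hY]
      linear_combination -4 * ((P k 0 - P l 0) ^ 2 + (P k 1 - P l 1) ^ 2) * h9
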